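/- Throughout, systems are finite-dimensional, $H(\rho)=-\operatorname{Tr}[\rho\log_2\rho]$ is the von Neumann entropy, and a quantum channel is a completely positive trace-preserving linear map. For a channel $\mathcal N$ and a finite ensemble $E=\{p_x,\rho_x\}_x$ of density matrices on its input system, let $$\chi(\mathcal N,E)=H\Big(\mathcal N\big(\textstyle\sum_x p_x\rho_x\big)\Big)-\sum_x p_x\,H\big(\mathcal N(\rho_x)\big),\qquad \chi(\mathcal N)=\max_E \chi(\mathcal N,E)$$ (the Holevo information of $\mathcal N$), and let the classical capacity of $\mathcal N$ be $C(\mathcal N)=\lim_{n\to\infty}\frac1n\chi(\mathcal N^{\otimes n})$. Let $\{\mathcal C_l\}_{l\in\mathsf L}$ be a finite collection of quantum channels from a system $A$ to a system $B$, let $p$ be a probability distribution on $\mathsf L$, and let $$\mathcal D(\cdot)=\sum_{l} p(l)\,\mathcal C_l(\cdot)\otimes|l\rangle\langle l|$$ be the labeled random channel, where $\{|l\rangle\}_{l\in\mathsf L}$ is an orthonormal basis of the label system. Suppose that there is a single ensemble $E$ on $A$ with $\chi(\mathcal C_l,E)=\chi(\mathcal C_l)$ for every $l$. Then $$\chi(\mathcal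 D)=\sum_l p(l)\,\chi(\mathcal C_l).$$ If, in addition, Holevo additivity holds among the channels $\mathcal C_l$, that is, $$\chi(\mathcal C_{l_1}\otimes\cdots\otimes\mathcal C_{l_n})=\chi(\mathcal C_{l_1})+\cdots+\chi(\mathcal C_{l_n})\quad\text{for all } n \text{ and all } l_1,\dots,l_n\in\mathsf L,$$ then the limit defining the classical capacity of $\mathcal D$ exists and $C(\mathcal D)=\chi(\mathcal D)$. -/

import Mathlib

open Matrix Filter Topology
open scoped Kronecker ComplexOrder

/-- A density matrix of the finite-dimensional system `ℂ^A`. -/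
structure IsDensityMatrix {A : Type*} [Fintype A] (ρ : Matrix A A ℂ) : Prop where
  posSemidef : ρ.PosSemidef
  trace_eq_one : ρ.trace = 1

/-- The von Neumann entropy `H(ρ) = - Tr[ρ log ρ]`, in bits, with `log ρ` given by the functional
calculus. As `logb 2 0 = 0`, the usual convention `0 log 0 = 0` is in force. -/
noncomputable def vonNeumannEntropy {B : Type*} [Fintype B] [DecidableEq B]
    (ρ : Matrix B B ℂ) : ℝ :=
  -((ρ * cfc (Real.logb 2) ρ).trace).re

theorem vonNeumannEntropy_eq_sum {B : Type*} [Fintype B] [DecidableEq B]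
    {ρ : Matrix B B ℂ} (h : ρ.IsHermitian) :
    vonNeumannEntropy ρ = (∑ i, Real.negMulLog (h.eigenvalues i)) / Real.log 2 := by
  have h1 : ρ * cfc (Real.logb 2) ρ = cfc (fun x => x * Real.logb 2 x) ρ := by
    have hf : ∀ f : ℝ → ℝ, ContinuousOn f (spectrum ℝ ρ) := fun f =>
      (Matrix.finite_real_spectrum (A := ρ)).continuousOn f
    rw [cfc_mul (fun x => x) _ ρ (hf _) (hf _)]
    congr 1
    exact (cfc_id' ℝ ρ h).symm
  rw [vonNeumannEntropy, h1, h.cfc_eq, Matrix.IsHermitian.cfc, Unitary.conjStarAlgAut_apply,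
    Matrix.trace_mul_cycle]
  simp only [Matrix.trace, Matrix.diag_apply, Complex.re_sum, Finset.sum_div,
    ← Finset.sum_neg_distrib, Unitary.coe_star_mul_self, one_mul, Matrix.diagonal_apply_eq,
    Function.comp_apply, Complex.coe_algebraMap, Complex.ofReal_re, Real.logb, Real.negMulLog]
  exact Finset.sum_congr rfl fun i _ => by ring

theorem IsDensityMatrix.sum_eigenvalues {B : Type*} [Fintype B] [DecidableEq B]
    {ρ : Matrix B B ℂ} (h : IsDensityMatrix ρ) : ∑ i, h.posSemidef.1.eigenvalues i = 1 := by
  have := h.posSemidef.1.trace_eq_sum_eigenvalues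
  rw [h.trace_eq_one] at this
  have h2 := congrArg Complex.re this
  simpa using h2.symm

theorem IsDensityMatrix.vonNeumannEntropy_nonneg {B : Type*} [Fintype B] [DecidableEq B]
    {ρ : Matrix B B ℂ} (h : IsDensityMatrix ρ) : 0 ≤ vonNeumannEntropy ρ := by
  rw [vonNeumannEntropy_eq_sum h.posSemidef.1]
  refine div_nonneg (Finset.sum_nonneg fun i _ => ?_) (Real.log_nonneg (by norm_num))
  have h0 := h.posSemidef.eigenvalues_nonneg
  refine Real.negMulLog_nonneg (h0 i) ?_
  rw [← h.sum_eigenvalues]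
  exact Finset.single_le_sum (fun j _ => h0 j) (Finset.mem_univ i)

/-- A crude dimension bound on the entropy. -/
theorem IsDensityMatrix.vonNeumannEntropy_le {B : Type*} [Fintype B] [DecidableEq B]
    {ρ : Matrix B B ℂ} (h : IsDensityMatrix ρ) :
    vonNeumannEntropy ρ ≤ Fintype.card B / Real.log 2 := by
  rw [vonNeumannEntropy_eq_sum h.posSemidef.1]
  refine div_le_div_of_nonneg_right ?_ (Real.log_nonneg (by norm_num))
  have : ∀ i, Real.negMulLog (h.posSemidef.1.eigenvalues i) ≤ 1 := fun i => by
    rcases (h.posSemidef.eigenvalues_nonneg i).eq_or_lt with h0 | h0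
    · rw [← h0]; simp
    · have h2 := Real.log_le_sub_one_of_pos (inv_pos.2 h0)
      rw [Real.log_inv] at h2
      have h3 := mul_le_mul_of_nonneg_left h2 h0.le
      rw [mul_sub, mul_inv_cancel₀ h0.ne'] at h3
      rw [Real.negMulLog]
      linarith
  calc _ ≤ ∑ _i : B, (1 : ℝ) := Finset.sum_le_sum fun i _ => this i
    _ = _ := by simp

/-- A quantum channel from the system `ℂ^A` to the system `ℂ^B`: a linear map on matrices with a
Kraus representation `X ↦ ∑ i, K i * X * (K i)ᴴ`, `∑ i, (K i)ᴴ * K i = 1` (equivalently, a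
completely positive trace-preserving linear map). -/
structure QuantumChannel (A B : Type*) [Fintype A] [DecidableEq A] [Fintype B] where
  toLinearMap : Matrix A A ℂ →ₗ[ℂ] Matrix B B ℂ
  exists_kraus : ∃ (r : ℕ) (K : Fin r → Matrix B A ℂ),
    ∑ i, (K i)ᴴ * K i = 1 ∧ ∀ X, toLinearMap X = ∑ i, K i * X * (K i)ᴴ

/-- A finite ensemble `(p_x, ρ_x)` of density matrices. -/
structure Ensemble (A : Type*) [Fintype A] where
  size : ℕ
  prob : Fin size → ℝ
  prob_mem : prob ∈ stdSimplex ℝ (Fin size)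
  state : Fin size → Matrix A A ℂ
  isDensityMatrix_state : ∀ x, IsDensityMatrix (state x)

/-- The average state `∑ x, p_x ρ_x` of an ensemble. -/
def Ensemble.average {A : Type*} [Fintype A] (E : Ensemble A) : Matrix A A ℂ :=
  ∑ x, (E.prob x : ℂ) • E.state x

theorem Ensemble.isDensityMatrix_average {A : Type*} [Fintype A] (E : Ensemble A) :
    IsDensityMatrix E.average where
  posSemidef := Matrix.posSemidef_sum _ fun x _ =>
    (E.isDensityMatrix_state x).posSemidef.smul (by exact_mod_cast E.prob_mem.1 x)
  trace_eq_one := by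
    simp only [Ensemble.average, Matrix.trace_sum, Matrix.trace_smul,
      (E.isDensityMatrix_state _).trace_eq_one, smul_eq_mul, mul_one]
    exact_mod_cast E.prob_mem.2

namespace QuantumChannel

theorem isDensityMatrix_apply {A B : Type*} [Fintype A] [DecidableEq A] [Fintype B]
    (N : QuantumChannel A B) {ρ : Matrix A A ℂ} (h : IsDensityMatrix ρ) :
    IsDensityMatrix (N.toLinearMap ρ) := by
  obtain ⟨r, K, hK, hN⟩ := N.exists_kraus
  rw [hN]
  refine ⟨Matrix.posSemidef_sum _ fun i _ => h.posSemidef.mul_mul_conjTranspose_same _, ?_⟩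
  have : ∀ i, (K i * ρ * (K i)ᴴ).trace = ((K i)ᴴ * K i * ρ).trace := fun i => by
    rw [Matrix.trace_mul_cycle]
  simp only [Matrix.trace_sum, this]
  rw [← Matrix.trace_sum, ← Finset.sum_mul, hK, one_mul, h.trace_eq_one]

/-- A Kraus representation may be indexed by any finite type. -/
theorem exists_kraus_of_fintype {A B : Type*} [Fintype A] [DecidableEq A] [Fintype B]
    (Φ : Matrix A A ℂ →ₗ[ℂ] Matrix B B ℂ) {κ : Type*} [Fintype κ] (K : κ → Matrix B A ℂ)
    (hK : ∑ i, (K i)ᴴ * K i = 1) (hΦ : ∀ X, Φ X = ∑ i, K i * X * (K i)ᴴ) :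
    ∃ (r : ℕ) (K : Fin r → Matrix B A ℂ),
      ∑ i, (K i)ᴴ * K i = 1 ∧ ∀ X, Φ X = ∑ i, K i * X * (K i)ᴴ := by
  refine ⟨Fintype.card κ, fun i => K ((Fintype.equivFin κ).symm i), ?_, fun X => ?_⟩
  · rw [← hK]
    exact (Fintype.equivFin κ).symm.sum_comp (fun i => (K i)ᴴ * K i)
  · rw [hΦ]
    exact ((Fintype.equivFin κ).symm.sum_comp (fun i => K i * X * (K i)ᴴ)).symm

section Holevo

variable {A B : Type*} [Fintype A] [DecidableEq A] [Fintype B] [DecidableEq B]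

/-- The Holevo quantity `H(N(∑ x, p_x ρ_x)) - ∑ x, p_x H(N(ρ_x))` of an input ensemble. -/
noncomputable def holevoQuantity (N : QuantumChannel A B) (E : Ensemble A) : ℝ :=
  vonNeumannEntropy (N.toLinearMap E.average)
    - ∑ x, E.prob x * vonNeumannEntropy (N.toLinearMap (E.state x))

/-- The Holevo information `χ(N)`: the optimum of the Holevo quantity over all finite ensembles. -/
noncomputable def holevoInformation (N : QuantumChannel A B) : ℝ :=
  ⨆ E : Ensemble A, N.holevoQuantity E

/-- The Holevo quantities of a channel are bounded, so that `holevoInformation` is a genuine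
supremum whenever the input system has a state. -/
theorem bddAbove_holevoQuantity (N : QuantumChannel A B) :
    BddAbove (Set.range N.holevoQuantity) := by
  refine ⟨Fintype.card B / Real.log 2, ?_⟩
  rintro _ ⟨E, rfl⟩
  have h1 := (N.isDensityMatrix_apply E.isDensityMatrix_average).vonNeumannEntropy_le
  have h2 : 0 ≤ ∑ x, E.prob x * vonNeumannEntropy (N.toLinearMap (E.state x)) :=
    Finset.sum_nonneg fun x _ => mul_nonneg (E.prob_mem.1 x)
      (N.isDensityMatrix_apply (E.isDensityMatrix_state x)).vonNeumannEntropy_nonneg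
  unfold holevoQuantity
  linarith

end Holevo

section Tensor

variable {ι A B : Type*} [Fintype ι] [DecidableEq ι] [Fintype A] [DecidableEq A] [Fintype B]

/-- The linear map underlying `⨂ k, C k`, written out on matrix units; the space `(ℂ^A)^{⊗ι}` is
`ℂ^(ι → A)`. -/
def tensorLinearMap (C : ι → QuantumChannel A B) :
    Matrix (ι → A) (ι → A) ℂ →ₗ[ℂ] Matrix (ι → B) (ι → B) ℂ where
  toFun X := Matrix.of fun b b' =>
    ∑ a, ∑ a', X a a' * ∏ k, (C k).toLinearMap (Matrix.single (a k) (a' k) 1) (b k) (b' k)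
  map_add' X Y := by
    ext b b'
    simp [add_mul, Finset.sum_add_distrib]
  map_smul' c X := by
    ext b b'
    simp [Finset.mul_sum, mul_assoc]

/-- `⨂ k, C k` maps `⨂ k, X k` to `⨂ k, C k (X k)`. -/
theorem tensorLinearMap_apply_prod (C : ι → QuantumChannel A B) (X : ι → Matrix A A ℂ) :
    tensorLinearMap C (Matrix.of fun a a' => ∏ k, X k (a k) (a' k))
      = Matrix.of fun b b' => ∏ k, (C k).toLinearMap (X k) (b k) (b' k) := by
  ext b b'
  have h : ∀ k, (C k).toLinearMap (X k) (b k) (b' k)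
      = ∑ a, ∑ a', X k a a' * (C k).toLinearMap (Matrix.single a a' 1) (b k) (b' k) := by
    intro k
    conv_lhs => rw [Matrix.matrix_eq_sum_single (X k)]
    simp only [map_sum, Matrix.sum_apply]
    refine Finset.sum_congr rfl fun a _ => Finset.sum_congr rfl fun a' _ => ?_
    have : Matrix.single a a' (X k a a') = X k a a' • Matrix.single a a' (1 : ℂ) := by simp
    rw [this, map_smul, Matrix.smul_apply, smul_eq_mul]
  simp only [tensorLinearMap, LinearMap.coe_mk, AddHom.coe_mk, Matrix.of_apply, h,
    Fintype.prod_sum, ← Finset.prod_mul_distrib]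

theorem exists_kraus_tensorLinearMap (C : ι → QuantumChannel A B) :
    ∃ (r : ℕ) (K : Fin r → Matrix (ι → B) (ι → A) ℂ),
      ∑ i, (K i)ᴴ * K i = 1 ∧ ∀ X, tensorLinearMap C X = ∑ i, K i * X * (K i)ᴴ := by
  choose r K hK hC using fun k => (C k).exists_kraus
  refine exists_kraus_of_fintype (tensorLinearMap C) (κ := (k : ι) → Fin (r k))
    (fun f => Matrix.of fun b a => ∏ k, K k (f k) (b k) (a k)) ?_ fun X => ?_
  · ext a a'
    have h : ∀ k, ∑ j, ∑ b, star (K k j b (a k)) * K k j b (a' k)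
        = (1 : Matrix A A ℂ) (a k) (a' k) := by
      intro k
      rw [← hK k]
      simp [Matrix.sum_apply, Matrix.mul_apply, Matrix.conjTranspose_apply]
    simp only [Matrix.sum_apply, Matrix.mul_apply, Matrix.conjTranspose_apply, Matrix.of_apply,
      star_prod, ← Finset.prod_mul_distrib]
    rw [show (1 : Matrix (ι → A) (ι → A) ℂ) a a' = ∏ k, (1 : Matrix A A ℂ) (a k) (a' k) by
      simp [Matrix.one_apply, Finset.prod_ite_zero, funext_iff]]
    simp only [← h, Fintype.prod_sum]
  · ext b b'
    have h : ∀ k (x y : A), (C k).toLinearMap (Matrix.single x y 1) (b k) (b' k)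
        = ∑ j, K k j (b k) x * star (K k j (b' k) y) := by
      intro k x y
      rw [hC]
      simp [Matrix.sum_apply, Matrix.mul_apply, Matrix.single_apply, ite_and]
    simp only [tensorLinearMap, LinearMap.coe_mk, AddHom.coe_mk, Matrix.of_apply, h,
      Fintype.prod_sum, Matrix.sum_apply, Matrix.mul_apply, Matrix.conjTranspose_apply, star_prod,
      Finset.prod_mul_distrib, Finset.mul_sum, Finset.sum_mul]
    rw [Finset.sum_comm]
    conv_lhs => enter [2, x]; rw [Finset.sum_comm]
    rw [Finset.sum_comm]
    refine Finset.sum_congr rfl fun f _ => Finset.sum_congr rfl fun a' _ =>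
      Finset.sum_congr rfl fun a _ => ?_
    ring

/-- The tensor product `⨂ k, C k` of finitely many channels. -/
def tensor (C : ι → QuantumChannel A B) : QuantumChannel (ι → A) (ι → B) where
  toLinearMap := tensorLinearMap C
  exists_kraus := exists_kraus_tensorLinearMap C

/-- The `n`-fold tensor power `N^{⊗n}`. -/
def tensorPower (N : QuantumChannel A B) (n : ℕ) :
    QuantumChannel (Fin n → A) (Fin n → B) :=
  tensor fun _ => N

end Tensor

/-- The classical capacity `C(N) = lim_{n → ∞} χ(N^{⊗n}) / n`, in bits per use of the channel. -/
noncomputable def classicalCapacity {A B : Type*} [Fintype A] [DecidableEq A] [Fintype B]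
    [DecidableEq B] (N : QuantumChannel A B) : ℝ :=
  limUnder atTop fun n : ℕ => (N.tensorPower n).holevoInformation / n

section LabeledRandom

variable {A B L : Type*} [Fintype A] [DecidableEq A] [Fintype B] [Fintype L] [DecidableEq L]

/-- The linear map `X ↦ ∑ l, p l • (C l X ⊗ |l⟩⟨l|)`. -/
def labeledRandomLinearMap (p : L → ℝ) (C : L → QuantumChannel A B) :
    Matrix A A ℂ →ₗ[ℂ] Matrix (B × L) (B × L) ℂ where
  toFun X := ∑ l, (p l : ℂ) • ((C l).toLinearMap X ⊗ₖ Matrix.single l l (1 : ℂ))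
  map_add' X Y := by
    simp [Matrix.add_kronecker, Finset.sum_add_distrib]
  map_smul' c X := by
    simp [Matrix.smul_kronecker, Finset.smul_sum, smul_comm c]

theorem exists_kraus_labeledRandomLinearMap (p : L → ℝ) (hp : p ∈ stdSimplex ℝ L)
    (C : L → QuantumChannel A B) :
    ∃ (r : ℕ) (K : Fin r → Matrix (B × L) A ℂ),
      ∑ i, (K i)ᴴ * K i = 1 ∧ ∀ X, labeledRandomLinearMap p C X = ∑ i, K i * X * (K i)ᴴ := by
  choose r K hK hC using fun l => (C l).exists_kraus
  have hs : ∀ l, (Real.sqrt (p l) : ℂ) * (Real.sqrt (p l) : ℂ) = p l := fun l => by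
    rw [← Complex.ofReal_mul, Real.mul_self_sqrt (hp.1 l)]
  refine exists_kraus_of_fintype (labeledRandomLinearMap p C) (κ := (l : L) × Fin (r l))
    (fun j => Matrix.of fun bl a =>
      if bl.2 = j.1 then (Real.sqrt (p j.1) : ℂ) * K j.1 j.2 bl.1 a else 0) ?_ fun X => ?_
  · have h : ∀ l i, (Matrix.of fun (bl : B × L) a =>
        if bl.2 = l then (Real.sqrt (p l) : ℂ) * K l i bl.1 a else 0)ᴴ *
        (Matrix.of fun (bl : B × L) a =>
        if bl.2 = l then (Real.sqrt (p l) : ℂ) * K l i bl.1 a else 0)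
        = (p l : ℂ) • ((K l i)ᴴ * K l i) := by
      intro l i
      ext a a'
      simp only [Matrix.mul_apply, Matrix.conjTranspose_apply, Matrix.of_apply,
        Fintype.sum_prod_type, Matrix.smul_apply, smul_eq_mul, Finset.mul_sum]
      refine Finset.sum_congr rfl fun b _ => ?_
      rw [← hs l]
      simp
      ring
    rw [Fintype.sum_sigma]
    simp only [h, ← Finset.smul_sum, hK]
    rw [← Finset.sum_smul, ← Complex.ofReal_sum, hp.2]
    simp
  · ext ⟨b, l⟩ ⟨b', l'⟩
    simp only [labeledRandomLinearMap, LinearMap.coe_mk, AddHom.coe_mk, Matrix.sum_apply,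
      Matrix.smul_apply, smul_eq_mul, Matrix.kroneckerMap_apply, Fintype.sum_sigma, hC, ← hs]
    refine Finset.sum_congr rfl fun m _ => ?_
    rw [Finset.sum_mul, Finset.mul_sum]
    refine Finset.sum_congr rfl fun i _ => ?_
    by_cases h1 : l = m <;> by_cases h2 : l' = m <;>
      simp [Matrix.mul_apply, h1, h2, eq_comm, Finset.mul_sum, Finset.sum_mul]
    refine Finset.sum_congr rfl fun a' _ => Finset.sum_congr rfl fun a _ => ?_
    ring

/-- The labeled random channel `∑ l, p l • C l (·) ⊗ |l⟩⟨l|`. -/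
def labeledRandom (p : L → ℝ) (hp : p ∈ stdSimplex ℝ L) (C : L → QuantumChannel A B) :
    QuantumChannel A (B × L) where
  toLinearMap := labeledRandomLinearMap p C
  exists_kraus := exists_kraus_labeledRandomLinearMap p hp C

end LabeledRandom

/-- Holevo additivity among the channels `C l`: the Holevo information is additive on every finite
tensor product, repetitions allowed, of channels of the collection. -/
def HolevoAdditive {A B L : Type*} [Fintype A] [DecidableEq A] [Fintype B] [DecidableEq B]
    (C : L → QuantumChannel A B) : Prop :=
  ∀ (n : ℕ) (w : Fin n → L),
    (tensor fun k => C (w k)).holevoInformation = ∑ k, (C (w k)).holevoInformation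

end QuantumChannel

/-! The label is classical: the output of a labeled random channel is block diagonal with blocks `p
l • C l ρ`, so its entropy is the entropy of `p` plus the average of the entropies of the `C l ρ`
(`vonNeumannEntropy_sum_kronecker_single`). The first term does not depend on the input and cancels
in the Holevo quantity, which is therefore the `p`-average of those of the `C l`, for each ensemble
(`holevoQuantity_labeledRandom`). The supremum of an average is at most the average of the suprema,
and a common optimal ensemble gives equality.

For the capacity, the `n`-th tensor power is again a labeled random channel up to the order of the
factors: its labels are words `w` under the product distribution, its channels the products of the
`C (w k)` (`tensorPower_labeledRandom_apply`). On each of these, `E.pow n` has Holevo quantity `∑ k,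
χ(C (w k))` (`holevoQuantity_tensor_pow`), which is optimal by Holevo additivity. So the first part
applies to the tensor power too and gives `n` times the one-shot value. -/

/-! ### Tensor products of families of matrices -/

namespace Matrix

variable {ι A B : Type*} [Fintype ι]

/-- The tensor product `⨂ k, M k` of a finite family of matrices. -/
def piKronecker (M : ι → Matrix A B ℂ) : Matrix (ι → A) (ι → B) ℂ :=
  Matrix.of fun a b => ∏ k, M k (a k) (b k)

theorem piKronecker_mul [DecidableEq ι] {D : Type*} [Fintype B] (M : ι → Matrix A B ℂ)
    (N : ι → Matrix B D ℂ) :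
    piKronecker M * piKronecker N = piKronecker fun k => M k * N k := by
  ext a d
  simp only [piKronecker, Matrix.mul_apply, Matrix.of_apply, ← Finset.prod_mul_distrib,
    Fintype.prod_sum]

theorem conjTranspose_piKronecker (M : ι → Matrix A B ℂ) :
    (piKronecker M)ᴴ = piKronecker fun k => (M k)ᴴ := by
  ext b a
  simp [piKronecker]

theorem piKronecker_diagonal [DecidableEq A] (d : ι → A → ℂ) :
    (piKronecker fun k => diagonal (d k)) = diagonal fun a => ∏ k, d k (a k) := by
  ext a a'
  simp [piKronecker, Matrix.diagonal_apply, Finset.prod_ite_zero, funext_iff]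

theorem piKronecker_one [DecidableEq A] :
    (piKronecker fun _ : ι => (1 : Matrix A A ℂ)) = 1 := by
  simp only [← Matrix.diagonal_one, piKronecker_diagonal, Finset.prod_const_one]

theorem trace_piKronecker [DecidableEq ι] [Fintype A] (M : ι → Matrix A A ℂ) :
    (piKronecker M).trace = ∏ k, (M k).trace := by
  simp only [Matrix.trace, Matrix.diag_apply, piKronecker, Matrix.of_apply, Fintype.prod_sum]

open scoped MatrixOrder Matrix.Norms.L2Operator in
theorem PosSemidef.piKronecker [Fintype A] {M : ι → Matrix A A ℂ} [DecidableEq ι]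
    (h : ∀ k, (M k).PosSemidef) : (piKronecker M).PosSemidef := by
  classical
  -- Factor each `M k` as `(N k)ᴴ * N k`; the tensor product then has the same form.
  choose N hN using fun k => CStarAlgebra.nonneg_iff_eq_star_mul_self.1 (h k).nonneg
  rw [show M = fun k => (N k)ᴴ * N k from funext hN, ← piKronecker_mul,
    ← conjTranspose_piKronecker]
  exact Matrix.posSemidef_conjTranspose_mul_self _

/-- Block diagonal form lets the spectra of the blocks be treated label by label. -/
theorem sum_smul_kronecker_single {L : Type*} [Fintype L] [DecidableEq L] (c : L → ℂ)
    (M : L → Matrix A B ℂ) :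
    ∑ l, c l • (M l ⊗ₖ Matrix.single l l (1 : ℂ)) = blockDiagonal fun l => c l • M l := by
  ext ⟨a, l⟩ ⟨b, l'⟩
  by_cases hl : l = l'
  · subst hl
    simp [Matrix.sum_apply, Matrix.single_apply, Matrix.blockDiagonal_apply]
  · simp only [Matrix.sum_apply, Matrix.blockDiagonal_apply, hl, if_false]
    refine Finset.sum_eq_zero fun m _ => ?_
    have : ¬ (m = l ∧ m = l') := fun hm => hl (hm.1.symm.trans hm.2)
    simp [this]

end Matrix

theorem IsDensityMatrix.piKronecker {ι A : Type*} [Fintype ι] [DecidableEq ι] [Fintype A]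
    {ρ : ι → Matrix A A ℂ} (h : ∀ k, IsDensityMatrix (ρ k)) :
    IsDensityMatrix (Matrix.piKronecker ρ) where
  posSemidef := Matrix.PosSemidef.piKronecker fun k => (h k).posSemidef
  trace_eq_one := by simp [Matrix.trace_piKronecker, (h _).trace_eq_one]

/-! ### Product distributions -/

/-- The expectation of a sum of functions of the coordinates under a product distribution. -/
theorem sum_prod_mul_sum {ι X : Type*} [Fintype ι] [DecidableEq ι] [Fintype X]
    (q h : ι → X → ℝ) (hq : ∀ k, ∑ x, q k x = 1) :
    ∑ x : ι → X, (∏ k, q k (x k)) * ∑ k, h k (x k) = ∑ k, ∑ x, q k x * h k x := by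
  simp only [Finset.mul_sum]
  rw [Finset.sum_comm]
  refine Finset.sum_congr rfl fun k _ => ?_
  -- Absorbing `h k` into the `k`-th factor makes the summand a pure product, so the sum over `x`
  -- factorizes.
  have h1 : ∀ x : ι → X, (∏ j, q j (x j)) * h k (x k)
      = ∏ j, q j (x j) * (if j = k then h j (x j) else 1) := fun x => by
    rw [Finset.prod_mul_distrib, Finset.prod_ite_eq']
    simp
  simp only [h1]
  rw [← Fintype.prod_sum (fun j x => q j x * (if j = k then h j x else 1)),
    ← Finset.mul_prod_erase _ _ (Finset.mem_univ k)]
  -- The factors other than the `k`-th are total masses, equal to 1.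
  rw [Finset.prod_eq_one, mul_one]
  · simp
  · intro j hj
    simp [Finset.ne_of_mem_erase hj, hq]

theorem prod_mem_stdSimplex {ι X : Type*} [Fintype ι] [DecidableEq ι] [Fintype X]
    {p : X → ℝ} (hp : p ∈ stdSimplex ℝ X) :
    (fun x : ι → X => ∏ k, p (x k)) ∈ stdSimplex ℝ (ι → X) := by
  refine ⟨fun x => Finset.prod_nonneg fun k _ => hp.1 _, ?_⟩
  rw [← Fintype.prod_sum (fun _ : ι => p)]
  simp [hp.2]

/-! ### Entropy from the spectrum -/

section Entropy

/-- The roots of the characteristic polynomial are the eigenvalues as a multiset. Comparing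
multisets avoids matching the ordering of `eigenvalues`, and leaves the index type of `d` free. -/
theorem sum_eigenvalues_eq_of_charpoly {B D : Type*} [Fintype B] [DecidableEq B] [Fintype D]
    {ρ : Matrix B B ℂ} (h : ρ.IsHermitian) (d : D → ℝ)
    (hd : ρ.charpoly = ∏ i, (Polynomial.X - Polynomial.C (d i : ℂ))) (f : ℝ → ℝ) :
    ∑ i, f (h.eigenvalues i) = ∑ i, f (d i) := by
  have h1 := h.roots_charpoly_eq_eigenvalues
  rw [hd, show ∏ i, (Polynomial.X - Polynomial.C (d i : ℂ))
    = ((Finset.univ.val.map fun i => (d i : ℂ)).map fun z => Polynomial.X - Polynomial.C z).prod by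
      rw [Multiset.map_map]; rfl, Polynomial.roots_multiset_prod_X_sub_C] at h1
  have h2 := congrArg (fun s => (s.map fun z : ℂ => f z.re).sum) h1
  simpa using h2.symm

theorem vonNeumannEntropy_eq_of_charpoly {B D : Type*} [Fintype B] [DecidableEq B] [Fintype D]
    {ρ : Matrix B B ℂ} (h : ρ.IsHermitian) (d : D → ℝ)
    (hd : ρ.charpoly = ∏ i, (Polynomial.X - Polynomial.C (d i : ℂ))) :
    vonNeumannEntropy ρ = (∑ i, Real.negMulLog (d i)) / Real.log 2 := by
  rw [vonNeumannEntropy_eq_sum h, sum_eigenvalues_eq_of_charpoly h d hd]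

/-- The entropy of a unitarily diagonalized matrix. -/
theorem vonNeumannEntropy_conj_diagonal {B : Type*} [Fintype B] [DecidableEq B]
    {U : Matrix B B ℂ} (hU : Uᴴ * U = 1) (d : B → ℝ) :
    vonNeumannEntropy (U * diagonal (fun i => (d i : ℂ)) * Uᴴ)
      = (∑ i, Real.negMulLog (d i)) / Real.log 2 := by
  refine vonNeumannEntropy_eq_of_charpoly ?_ d ?_
  · refine Matrix.isHermitian_mul_mul_conjTranspose _ ?_
    exact Matrix.isHermitian_diagonal_iff.2 fun i => by simp [IsSelfAdjoint]
  · rw [Matrix.mul_assoc, Matrix.charpoly_mul_comm, Matrix.mul_assoc, hU, Matrix.mul_one,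
      Matrix.charpoly_diagonal]

theorem vonNeumannEntropy_submatrix {B D : Type*} [Fintype B] [DecidableEq B] [Fintype D]
    [DecidableEq D] {ρ : Matrix B B ℂ} (h : ρ.IsHermitian) (e : D ≃ B) :
    vonNeumannEntropy (ρ.submatrix e e) = vonNeumannEntropy ρ := by
  rw [vonNeumannEntropy_eq_sum h, vonNeumannEntropy_eq_of_charpoly (h.submatrix e) h.eigenvalues]
  exact (Matrix.charpoly_reindex e.symm ρ).trans h.charpoly_eq

/-- A density matrix has a unitary diagonalization by a probability distribution. -/
theorem IsDensityMatrix.exists_diagonalization {B : Type*} [Fintype B] [DecidableEq B]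
    {ρ : Matrix B B ℂ} (h : IsDensityMatrix ρ) :
    ∃ (U : Matrix B B ℂ) (d : B → ℝ), Uᴴ * U = 1 ∧ ∑ i, d i = 1 ∧
      ρ = U * diagonal (fun i => (d i : ℂ)) * Uᴴ := by
  refine ⟨h.posSemidef.1.eigenvectorUnitary, h.posSemidef.1.eigenvalues,
    Unitary.coe_star_mul_self _, h.sum_eigenvalues, ?_⟩
  conv_lhs => rw [h.posSemidef.1.spectral_theorem, Unitary.conjStarAlgAut_apply]
  rfl

/-- The entropy is additive on tensor products. -/
theorem vonNeumannEntropy_piKronecker {ι B : Type*} [Fintype ι] [DecidableEq ι] [Fintype B]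
    [DecidableEq B] {ρ : ι → Matrix B B ℂ} (h : ∀ k, IsDensityMatrix (ρ k)) :
    vonNeumannEntropy (piKronecker ρ) = ∑ k, vonNeumannEntropy (ρ k) := by
  choose U d hU hd hρ using fun k => (h k).exists_diagonalization
  have h1 : piKronecker ρ = piKronecker U * diagonal (fun b => ((∏ k, d k (b k) : ℝ) : ℂ))
      * (piKronecker U)ᴴ := by
    simp only [Complex.ofReal_prod]
    rw [conjTranspose_piKronecker, ← piKronecker_diagonal fun k b => (d k b : ℂ),
      piKronecker_mul, piKronecker_mul]
    exact congrArg _ (funext hρ)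
  have h2 : (piKronecker U)ᴴ * piKronecker U = 1 := by
    rw [conjTranspose_piKronecker, piKronecker_mul]
    simp only [hU, piKronecker_one]
  -- A vanishing product kills both sides, whatever the logarithms of its zero factors are;
  -- otherwise the logarithm splits.
  have h3 : ∀ b : ι → B, Real.negMulLog (∏ k, d k (b k))
      = (∏ k, d k (b k)) * ∑ k, -Real.log (d k (b k)) := fun b => by
    by_cases hb : ∏ k, d k (b k) = 0
    · simp [hb]
    · rw [Real.negMulLog, Real.log_prod fun k hk => Finset.prod_ne_zero_iff.1 hb k hk]
      simp
  have h4 : ∀ k, vonNeumannEntropy (ρ k) = (∑ b, d k b * -Real.log (d k b)) / Real.log 2 := by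
    intro k
    rw [hρ k, vonNeumannEntropy_conj_diagonal (hU k)]
    simp [Real.negMulLog]
  rw [h1, vonNeumannEntropy_conj_diagonal h2]
  simp only [h3, h4]
  rw [sum_prod_mul_sum d (fun k b => -Real.log (d k b)) hd, Finset.sum_div]

/-- The entropy of a mixture of labeled states: the entropy of the label plus the average of the
entropies of the states. -/
theorem vonNeumannEntropy_sum_kronecker_single {B L : Type*} [Fintype B] [DecidableEq B]
    [Fintype L] [DecidableEq L] (p : L → ℝ) {ρ : L → Matrix B B ℂ}
    (h : ∀ l, IsDensityMatrix (ρ l)) :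
    vonNeumannEntropy (∑ l, (p l : ℂ) • (ρ l ⊗ₖ Matrix.single l l (1 : ℂ)))
      = (∑ l, Real.negMulLog (p l)) / Real.log 2 + ∑ l, p l * vonNeumannEntropy (ρ l) := by
  choose U d hU hd hρ using fun l => (h l).exists_diagonalization
  have h1 : ∑ l, (p l : ℂ) • (ρ l ⊗ₖ Matrix.single l l (1 : ℂ))
      = blockDiagonal U * diagonal (fun bl : B × L => ((p bl.2 * d bl.2 bl.1 : ℝ) : ℂ))
        * (blockDiagonal U)ᴴ := by
    rw [Matrix.sum_smul_kronecker_single, Matrix.blockDiagonal_conjTranspose,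
      ← Matrix.blockDiagonal_diagonal fun l b => ((p l * d l b : ℝ) : ℂ),
      ← Matrix.blockDiagonal_mul, ← Matrix.blockDiagonal_mul]
    refine congrArg _ (funext fun l => ?_)
    conv_lhs => rw [hρ l]
    rw [← Matrix.smul_mul, ← Matrix.mul_smul, ← Matrix.diagonal_smul]
    congr 3
    ext b
    simp
  have h3 : (blockDiagonal U)ᴴ * blockDiagonal U = 1 := by
    rw [Matrix.blockDiagonal_conjTranspose, ← Matrix.blockDiagonal_mul]
    simp only [hU]
    exact Matrix.blockDiagonal_one
  rw [h1, vonNeumannEntropy_conj_diagonal h3, Fintype.sum_prod_type_right, ← sub_eq_zero]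
  have h4 : ∀ l, vonNeumannEntropy (ρ l) = (∑ b, Real.negMulLog (d l b)) / Real.log 2 := by
    intro l
    rw [hρ l, vonNeumannEntropy_conj_diagonal (hU l)]
  -- `Real.negMulLog_mul` is the chain rule for the product `p l * d l b`, valid at zero too;
  -- summing over `b` with `∑ b, d l b = 1` leaves the label entropy.
  simp only [h4, Real.negMulLog_mul, Finset.sum_add_distrib, ← Finset.mul_sum,
    ← Finset.sum_mul, hd, one_mul, mul_div_assoc']
  rw [← Finset.sum_div]
  ring

end Entropy

/-! ### Product ensembles -/

/-- The `n`-fold product ensemble `E^{⊗n}`. -/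
noncomputable def Ensemble.pow {A : Type*} [Fintype A] (E : Ensemble A) (n : ℕ) :
    Ensemble (Fin n → A) where
  size := Fintype.card (Fin n → Fin E.size)
  prob i := ∏ k, E.prob ((Fintype.equivFin (Fin n → Fin E.size)).symm i k)
  prob_mem := by
    have h := prod_mem_stdSimplex (ι := Fin n) E.prob_mem
    exact ⟨fun i => h.1 _, by
      rw [(Fintype.equivFin (Fin n → Fin E.size)).symm.sum_comp fun x => ∏ k, E.prob (x k)]
      exact h.2⟩
  state i := piKronecker fun k =>
    E.state ((Fintype.equivFin (Fin n → Fin E.size)).symm i k)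
  isDensityMatrix_state i := IsDensityMatrix.piKronecker fun k => E.isDensityMatrix_state _

theorem Ensemble.average_pow {A : Type*} [Fintype A] (E : Ensemble A) (n : ℕ) :
    (E.pow n).average = piKronecker fun _ => E.average := by
  have h : (E.pow n).average = ∑ x : Fin n → Fin E.size,
      ((∏ k, E.prob (x k) : ℝ) : ℂ) • piKronecker fun k => E.state (x k) :=
    (Fintype.equivFin (Fin n → Fin E.size)).symm.sum_comp fun x =>
      ((∏ k, E.prob (x k) : ℝ) : ℂ) • piKronecker fun k => E.state (x k)
  rw [h]
  ext a a'
  simp only [piKronecker, Ensemble.average, Matrix.sum_apply, Matrix.smul_apply, smul_eq_mul,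
    Matrix.of_apply, Fintype.prod_sum, Finset.prod_mul_distrib, Complex.ofReal_prod]

/-! ### Holevo information of labeled random channels and their powers -/

namespace QuantumChannel

/-- A tensor power of a labeled random channel is, up to the order of the tensor factors, the
labeled random channel of the product channels. -/
theorem tensorPower_labeledRandom_apply {A B L : Type*} [Fintype A]
    [DecidableEq A] [Fintype B] [Fintype L] [DecidableEq L] (p : L → ℝ)
    (hp : p ∈ stdSimplex ℝ L) (C : L → QuantumChannel A B) (n : ℕ)
    (X : Matrix (Fin n → A) (Fin n → A) ℂ) :
    ((labeledRandom p hp C).tensorPower n).toLinearMap X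
      = ((labeledRandom (fun w : Fin n → L => ∏ k, p (w k)) (prod_mem_stdSimplex hp)
          fun w => tensor fun k => C (w k)).toLinearMap X).submatrix
        (Equiv.arrowProdEquivProdArrow (Fin n) (fun _ => B) fun _ => L)
        (Equiv.arrowProdEquivProdArrow (Fin n) (fun _ => B) fun _ => L) := by
  ext b b'
  change ∑ a, ∑ a', X a a' * ∏ k, labeledRandomLinearMap p C (Matrix.single (a k) (a' k) 1)
      (b k) (b' k) = labeledRandomLinearMap (fun w : Fin n → L => ∏ k, p (w k))
        (fun w => tensor fun k => C (w k)) X (fun k => (b k).1, fun k => (b k).2)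
        (fun k => (b' k).1, fun k => (b' k).2)
  simp only [labeledRandomLinearMap, LinearMap.coe_mk, AddHom.coe_mk,
    Matrix.sum_smul_kronecker_single, Matrix.blockDiagonal_apply, Matrix.smul_apply, smul_eq_mul,
    Finset.prod_ite_zero, Finset.mem_univ, true_imp_iff, funext_iff]
  -- Both sides vanish unless the row and column label words agree.
  split_ifs
  · simp only [tensor, tensorLinearMap, LinearMap.coe_mk, AddHom.coe_mk, Matrix.of_apply,
      Finset.prod_mul_distrib, Finset.mul_sum, Complex.ofReal_prod, mul_left_comm]
  · simp

section

variable {A B L : Type*} [Fintype A] [DecidableEq A] [Fintype B] [DecidableEq B]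

/-- On a product ensemble, the Holevo quantity of a product channel is additive. -/
theorem holevoQuantity_tensor_pow {n : ℕ} (C : Fin n → QuantumChannel A B) (E : Ensemble A) :
    (tensor C).holevoQuantity (E.pow n) = ∑ k, (C k).holevoQuantity E := by
  have h : ∀ ρ : Fin n → Matrix A A ℂ, (∀ k, IsDensityMatrix (ρ k)) →
      vonNeumannEntropy ((tensor C).toLinearMap (piKronecker ρ))
        = ∑ k, vonNeumannEntropy ((C k).toLinearMap (ρ k)) := fun ρ hρ => by
    rw [← vonNeumannEntropy_piKronecker fun k => (C k).isDensityMatrix_apply (hρ k)]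
    exact congrArg _ (tensorLinearMap_apply_prod C ρ)
  simp only [holevoQuantity, Finset.sum_sub_distrib]
  congr 1
  · rw [E.average_pow, h _ fun _ => E.isDensityMatrix_average]
  · rw [← sum_prod_mul_sum (fun _ => E.prob)
      (fun k x => vonNeumannEntropy ((C k).toLinearMap (E.state x))) fun _ => E.prob_mem.2]
    simp only [← h _ fun k => E.isDensityMatrix_state _]
    exact (Fintype.equivFin (Fin n → Fin E.size)).symm.sum_comp fun x =>
      (∏ k, E.prob (x k)) *
        vonNeumannEntropy ((tensor C).toLinearMap (piKronecker fun k => E.state (x k)))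

variable [Fintype L] [DecidableEq L]

/-- The Holevo quantity of a labeled random channel is the average of the Holevo quantities. -/
theorem holevoQuantity_labeledRandom (p : L → ℝ) (hp : p ∈ stdSimplex ℝ L)
    (C : L → QuantumChannel A B) (E : Ensemble A) :
    (labeledRandom p hp C).holevoQuantity E = ∑ l, p l * (C l).holevoQuantity E := by
  have h : ∀ ρ : Matrix A A ℂ, IsDensityMatrix ρ →
      vonNeumannEntropy ((labeledRandom p hp C).toLinearMap ρ)
        = (∑ l, Real.negMulLog (p l)) / Real.log 2
          + ∑ l, p l * vonNeumannEntropy ((C l).toLinearMap ρ) := fun ρ hρ =>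
    vonNeumannEntropy_sum_kronecker_single p fun l => (C l).isDensityMatrix_apply hρ
  -- As the ensemble weights sum to 1, the label entropy occurs once with each sign; `ring` cancels
  -- it at the end.
  simp only [holevoQuantity, h _ E.isDensityMatrix_average, h _ (E.isDensityMatrix_state _),
    mul_add, Finset.sum_add_distrib, ← Finset.sum_mul, E.prob_mem.2, one_mul, mul_sub,
    Finset.sum_sub_distrib, Finset.mul_sum]
  rw [Finset.sum_comm (s := (Finset.univ : Finset (Fin E.size)))]
  simp only [mul_left_comm (p _)]
  ring

/-- If one ensemble is optimal for every `C l`, then the Holevo information of the labeled random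
channel is the average of the Holevo informations. -/
theorem holevoInformation_labeledRandom (p : L → ℝ) (hp : p ∈ stdSimplex ℝ L)
    (C : L → QuantumChannel A B) {E : Ensemble A}
    (hE : ∀ l, (C l).holevoQuantity E = (C l).holevoInformation) :
    (labeledRandom p hp C).holevoInformation = ∑ l, p l * (C l).holevoInformation := by
  apply le_antisymm
  · have : Nonempty (Ensemble A) := ⟨E⟩
    refine ciSup_le fun E' => ?_
    rw [holevoQuantity_labeledRandom]
    exact Finset.sum_le_sum fun l _ => mul_le_mul_of_nonneg_left
      (le_ciSup (C l).bddAbove_holevoQuantity E') (hp.1 l)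
  · simp only [← hE]
    rw [← holevoQuantity_labeledRandom p hp]
    exact le_ciSup (labeledRandom p hp C).bddAbove_holevoQuantity E

/-- Reordering the output factors is a permutation of the basis, which preserves entropy; the input
ensembles are the same on both sides. -/
theorem holevoInformation_tensorPower_labeledRandom (p : L → ℝ) (hp : p ∈ stdSimplex ℝ L)
    (C : L → QuantumChannel A B) (n : ℕ) :
    ((labeledRandom p hp C).tensorPower n).holevoInformation
      = (labeledRandom (fun w : Fin n → L => ∏ k, p (w k)) (prod_mem_stdSimplex hp)
          fun w => tensor fun k => C (w k)).holevoInformation := by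
  have h : ∀ ρ : Matrix (Fin n → A) (Fin n → A) ℂ, IsDensityMatrix ρ →
      vonNeumannEntropy (((labeledRandom p hp C).tensorPower n).toLinearMap ρ)
        = vonNeumannEntropy ((labeledRandom (fun w : Fin n → L => ∏ k, p (w k))
          (prod_mem_stdSimplex hp) fun w => tensor fun k => C (w k)).toLinearMap ρ) :=
    fun ρ hρ => by
      rw [tensorPower_labeledRandom_apply]
      exact vonNeumannEntropy_submatrix (isDensityMatrix_apply _ hρ).posSemidef.1 _
  refine iSup_congr fun E => ?_
  simp only [holevoQuantity, h _ E.isDensityMatrix_average, h _ (E.isDensityMatrix_state _)]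

/-- If one ensemble is optimal for every `C l` and Holevo additivity holds among the `C l`, then the
Holevo information is additive on tensor powers of the labeled random channel. -/
theorem holevoInformation_tensorPower_labeledRandom_eq_mul (p : L → ℝ)
    (hp : p ∈ stdSimplex ℝ L) (C : L → QuantumChannel A B) {E : Ensemble A}
    (hE : ∀ l, (C l).holevoQuantity E = (C l).holevoInformation) (hC : HolevoAdditive C)
    (n : ℕ) :
    ((labeledRandom p hp C).tensorPower n).holevoInformation
      = n * (labeledRandom p hp C).holevoInformation := by
  -- The averaging formula is used twice: with `E` for single letters, then with `E.pow n` for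
  -- words.
  rw [holevoInformation_tensorPower_labeledRandom, holevoInformation_labeledRandom p hp C hE,
    holevoInformation_labeledRandom (E := E.pow n)]
  · simp only [hC n]
    rw [sum_prod_mul_sum (fun _ : Fin n => p) (fun _ l => (C l).holevoInformation)
      fun _ => hp.2]
    simp
  · intro w
    rw [holevoQuantity_tensor_pow, hC n]
    exact Finset.sum_congr rfl fun k _ => hE (w k)

end

end QuantumChannel

/-! ### The main theorem -/

/-- If one ensemble `E` attains the Holevo information of every `C l`, then the labeled random
channel has Holevo information `∑ l, p l * χ(C l)`; if moreover Holevo additivity holds among the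
`C l`, the limit defining its classical capacity exists and equals its Holevo information. -/
theorem mainTheorem7 {A B L : Type*} [Fintype A] [DecidableEq A] [Fintype B] [DecidableEq B]
    [Fintype L] [DecidableEq L] (C : L → QuantumChannel A B)
    (p : L → ℝ) (hp : p ∈ stdSimplex ℝ L)
    (hfixed : ∃ E : Ensemble A, ∀ l, (C l).holevoQuantity E = (C l).holevoInformation) :
    (QuantumChannel.labeledRandom p hp C).holevoInformation
        = ∑ l, p l * (C l).holevoInformation ∧
      (QuantumChannel.HolevoAdditive C →
        Tendsto (fun n : ℕ =>
            ((QuantumChannel.labeledRandom p hp C).tensorPower n).holevoInformation / n)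
          atTop (𝓝 (QuantumChannel.labeledRandom p hp C).classicalCapacity) ∧
        (QuantumChannel.labeledRandom p hp C).classicalCapacity
          = (QuantumChannel.labeledRandom p hp C).holevoInformation) := by
  obtain ⟨E, hE⟩ := hfixed
  refine ⟨QuantumChannel.holevoInformation_labeledRandom p hp C hE, fun hC => ?_⟩
  have h : Tendsto (fun n : ℕ =>
      ((QuantumChannel.labeledRandom p hp C).tensorPower n).holevoInformation / n)
      atTop (𝓝 (QuantumChannel.labeledRandom p hp C).holevoInformation) := by
    refine tendsto_const_nhds.congr' ?_
    -- The quotient is constant for nonzero `n`; at `n = 0` it is the default value of division by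
    -- zero.
    filter_upwards [eventually_ne_atTop 0] with n hn
    rw [QuantumChannel.holevoInformation_tensorPower_labeledRandom_eq_mul p hp C hE hC,
      mul_div_cancel_left₀ _ (Nat.cast_ne_zero.2 hn)]
  -- `limUnder` carries meaning only for a convergent sequence, which `h` supplies.
  have h2 : (QuantumChannel.labeledRandom p hp C).classicalCapacity
      = (QuantumChannel.labeledRandom p hp C).holevoInformation := h.limUnder_eq
  exact ⟨h2 ▸ h, h2⟩
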